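/- Let $I\subseteq\mathbb R$ be an interval, let $f_0\ge 0$ and $h_0$ be functions on $I$, and let $S_0$ be the surface of revolution $$(v,\theta)\mapsto (f_0(v)\cos\theta,\ f_0(v)\sin\theta,\ h_0(v)),\qquad v\in I,$$ which is assumed connected, complete (for the intrinsic distance induced from $\mathbb R^3$), without boundary, and smoothly immersed in $\mathbb R^3$ by this parametrization; at a pole (a parameter $p\in I$ with $f_0(p)=0$) this means that $p$ is an endpoint of $I$ and that, with $(|v-p|,\theta)$ as polar coordinates on a disc, the parametrization is a smooth immersion of the disc. (For a surface generated by a closed profile curve off the axis, $I=\mathbb R$ and $f_0,h_0$ are periodic.) Let $T\in(0,\infty]$ and let $S(t)$, $0\le t<T$, be a conformal extrinsic flow of such smoothly immersed surfaces $$(v,\theta)\mapsto (f(v,t)\cos\theta,\ f(v,t)\sin\theta,\ h(v,t)),\qquad v\in I,$$ where $f,h$ are smooth on $I\times[0,T)$, $f(\cdot,0)=f_0$, $h(\cdot,0)=h_0$, $f(p,t)=0$ for all $t$ whenever $f_0(p)=0$, and, for every $t$, the metric induced on $S(t)$ by $\mathbb R^3$ is, in the coordinates $(v,\theta)$, a positive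 function times the metric induced on $S_0$. (The surfaces $S(t)$, $t>0$, are not assumed complete.) Let $q\in I$ with $f_0(q)\neq 0$, put $I'=\{v\in I: f_0(v)\ne 0\}$, and for $v\in I'$ let $$\xi(v)=\int_q^v \frac{\sqrt{f_0'(s)^2+h_0'(s)^2}}{f_0(s)}\,ds .$$ Then: 1. The integral converges for every $v\in I'$, and $\xi:I'\to\mathbb R$ is smooth with range $(-\infty,\infty)$ and has a smooth inverse $V:\mathbb R\to I'$. (Neither $\xi$ nor $V$ depends on $t$.) 2. If $p\in I$ and $f_0(p)=0$, then either $p<q$, $\xi(v)\to-\infty$ as $v\to p$ in $I'$, and $V(\xi)\to p$ as $\xi\to-\infty$; or $p>q$, $\xi(v)\to\infty$ as $v\to p$ in $I'$, and $V(\xi)\to p$ as $\xi\to\infty$. 3. Write $f(\xi,t)=f(V(\xi),t)$ and $h(\xi,t)=h(V(\xi),t)$. These functions are smooth on $\mathbb R\times[0,T)$, and for all $t\in[0,T)$ and $\xi\in\mathbb R$ $$f_\xi^2+h_\xi^2=f^2,$$ and the metric induced by $\mathbb R^3$ in the coordinates $(\xi,\theta)$ is $$g_E(\xi,t)=f(\xi,t)^2\,[\,d\xi^2+d\theta^2\,].$$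 -/

import Mathlib

open Set Filter Topology MeasureTheory
open scoped ContDiff ENNReal

noncomputable section

/-- Euclidean three-space. -/
abbrev E3 : Type := EuclideanSpace ℝ (Fin 3)

/-- The parametrization `(v, θ) ↦ (f(v) cos θ, f(v) sin θ, h(v))` of the surface of revolution
with profile curve `(f, h)`; the axis of revolution is the `z`-axis. -/
def revolve (f h : ℝ → ℝ) (p : ℝ × ℝ) : E3 :=
  !₂[f p.1 * Real.cos p.2, f p.1 * Real.sin p.2, h p.1]

/-- The same parametrization, with the angle taken modulo `2π`. -/
def revolveAngle (f h : ℝ → ℝ) (p : ℝ × Real.Angle) : E3 :=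
  !₂[f p.1 * p.2.cos, f p.1 * p.2.sin, h p.1]

/-- The pull-back of the Euclidean metric of three-space under `X : ℝ² → E3`, at the point `p`,
evaluated on the tangent vectors `a`, `b`. -/
def inducedMetric (X : ℝ × ℝ → E3) (p a b : ℝ × ℝ) : ℝ :=
  inner ℝ (fderiv ℝ X p a) (fderiv ℝ X p b)

/-- The parameters in `I` that are not pole locations.  A pole is a point of the surface on the
axis of revolution, that is, a point with `f = 0`. -/
def nonPoles (I : Set ℝ) (f : ℝ → ℝ) : Set ℝ := {v ∈ I | f v ≠ 0}

/-- The surface of revolution with profile `(f, h)` on `I` is smoothly immersed, with no boundary,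
at the pole with parameter `p`: the parameter set is one-sided at `p`, and, with
`r = |v - p|` and `θ` as polar coordinates in the plane, the parametrization near the pole
is a smooth map `G` on a disc about the origin, which is an immersion at the origin. -/
def ImmersedAtPole (I : Set ℝ) (f h : ℝ → ℝ) (p : ℝ) : Prop :=
  ∃ σ ε : ℝ, (σ = 1 ∨ σ = -1) ∧ 0 < ε ∧
    I ∩ Ioo (p - ε) (p + ε) = (fun r => p + σ * r) '' Ico 0 ε ∧
    ∃ G : ℝ × ℝ → E3,
      ContDiffOn ℝ ∞ G {z | z.1 ^ 2 + z.2 ^ 2 < ε ^ 2} ∧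
      Function.Injective (fderiv ℝ G 0) ∧
      ∀ r ∈ Ico 0 ε, ∀ θ : ℝ,
        G (r * Real.cos θ, r * Real.sin θ) = revolve f h (p + σ * r, θ)

/-- `(v, θ) ↦ (f(v) cos θ, f(v) sin θ, h(v))`, `v ∈ I`, parametrizes a connected surface
of revolution without boundary, smoothly immersed in three-space: `I` is an interval, every
`v ∈ I` off the axis is an interior point of `I` at which the parametrization is a smooth
immersion, and the surface is smoothly immersed at its poles. -/
structure IsImmersedRevolution (I : Set ℝ) (f h : ℝ → ℝ) : Prop where
  interval : I.OrdConnected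
  regular : ∀ v ∈ nonPoles I f, v ∈ interior I ∧
    ∀ θ : ℝ, ContDiffAt ℝ ∞ (revolve f h) (v, θ) ∧
      Function.Injective (fderiv ℝ (revolve f h) (v, θ))
  pole : ∀ p ∈ I, f p = 0 → ImmersedAtPole I f h p

/-- The intrinsic distance on the surface: the infimum of the Euclidean lengths (total variations)
in three-space of continuous paths in the surface.  The circle `v = p` over a pole location
has length zero, so its points are at distance zero from each other and
represent the same point of the surface. -/
def intrinsicEDist (I : Set ℝ) (f h : ℝ → ℝ) (x y : I × Real.Angle) : ℝ≥0∞ :=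
  ⨅ γ : Path x y,
    eVariationOn (fun s => revolveAngle f h (((γ s).1 : ℝ), (γ s).2)) univ

/-- The surface is complete: Cauchy sequences for its intrinsic distance converge in it. -/
def IsCompleteRevolution (I : Set ℝ) (f h : ℝ → ℝ) : Prop :=
  ∀ u : ℕ → I × Real.Angle,
    (∀ ε : ℝ≥0∞, 0 < ε → ∃ N, ∀ m ≥ N, ∀ n ≥ N, intrinsicEDist I f h (u m) (u n) < ε) →
    ∃ a : I × Real.Angle, Tendsto (fun n => intrinsicEDist I f h (u n) a) atTop (𝓝 0)

/-- The time interval `[0, T)`, where `T = ⊤` is allowed. -/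
def timeDomain (T : EReal) : Set ℝ := {t : ℝ | 0 ≤ t ∧ (t : EReal) < T}

/-- A conformal extrinsic flow, for times in `[0, T)`, of smoothly immersed surfaces of revolution
`S(t)` with profile `(f(·, t), h(·, t))` on `I`; poles of `S(0)` stay poles. -/
structure IsConformalExtrinsicFlow (I : Set ℝ) (T : EReal) (f h : ℝ → ℝ → ℝ) : Prop where
  smooth_f : ContDiffOn ℝ ∞ (fun z : ℝ × ℝ => f z.1 z.2) (I ×ˢ timeDomain T)
  smooth_h : ContDiffOn ℝ ∞ (fun z : ℝ × ℝ => h z.1 z.2) (I ×ˢ timeDomain T)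
  immersed : ∀ t ∈ timeDomain T, IsImmersedRevolution I (fun v => f v t) (fun v => h v t)
  pole_fixed : ∀ p ∈ I, f p 0 = 0 → ∀ t ∈ timeDomain T, f p t = 0
  conformal : ∀ t ∈ timeDomain T, ∃ lam : ℝ × ℝ → ℝ,
    ∀ v ∈ nonPoles I (fun v => f v 0), ∀ θ : ℝ, 0 < lam (v, θ) ∧
      ∀ a b : ℝ × ℝ,
        inducedMetric (revolve (fun v => f v t) (fun v => h v t)) (v, θ) a b =
          lam (v, θ) * inducedMetric (revolve (fun v => f v 0) (fun v => h v 0)) (v, θ) a b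

/-- The integrand `√(f₀'² + h₀'²) / f₀`. -/
def xiIntegrand (f₀ h₀ : ℝ → ℝ) (s : ℝ) : ℝ :=
  Real.sqrt (deriv f₀ s ^ 2 + deriv h₀ s ^ 2) / f₀ s

/-- The coordinate `ξ(v) = ∫_q^v √(f₀'² + h₀'²) / f₀ ds`. -/
def xi (f₀ h₀ : ℝ → ℝ) (q v : ℝ) : ℝ := ∫ s in q..v, xiIntegrand f₀ h₀ s

end

/-! ### The metric of a surface of revolution -/

/-! The metric `(f'² + h'²) dv² + f² dθ²` becomes `f² (dξ² + dθ²)` when `dξ` is the arc length of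
the profile divided by the radius. The substantial claim is that `ξ` has range `ℝ`.

Since `|f'| ≤ √(f'² + h'²)`, the function `log f` is 1-Lipschitz in `ξ` (`abs_log_sub_le`). Hence on
`|ξ| ≤ M` the radius stays between `f(q) e^{-M}` and `f(q) e^M`: the upper bound makes lengths of
meridians Lipschitz in `ξ`, the lower one keeps away from the poles. If `ξ(v n)` converges, the
points are therefore intrinsically Cauchy, completeness gives a limit, the limit is off the axis,
and the parameters converge to it (`exists_tendsto_of_tendsto_xi`). So the range is closed; it is
open because `ξ' > 0`, and `ℝ` is connected (`image_xi_eq_univ`).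

The behaviour at the poles needs no estimate: a pole is an endpoint of `I`, and an increasing
bijection onto `ℝ` must diverge there. For `t > 0`, conformality makes the ratio of the two metric
coefficients independent of time (`conformal_profile`), so the same `ξ` serves every `S(t)`. -/

theorem differentiableAt_revolve {f h : ℝ → ℝ} {v : ℝ} (hf : DifferentiableAt ℝ f v)
    (hh : DifferentiableAt ℝ h v) (θ : ℝ) : DifferentiableAt ℝ (revolve f h) (v, θ) := by
  have hf' : DifferentiableAt ℝ (fun p : ℝ × ℝ => f p.1) (v, θ) :=
    DifferentiableAt.fun_comp' (f := fun p : ℝ × ℝ => p.1) (v, θ) hf differentiableAt_fst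
  have hh' : DifferentiableAt ℝ (fun p : ℝ × ℝ => h p.1) (v, θ) :=
    DifferentiableAt.fun_comp' (f := fun p : ℝ × ℝ => p.1) (v, θ) hh differentiableAt_fst
  rw [differentiableAt_euclidean]
  intro i
  fin_cases i
  · simp only [revolve]; simp; fun_prop
  · simp only [revolve]; simp; fun_prop
  · simpa [revolve] using hh'

theorem fderiv_revolve_apply {f h : ℝ → ℝ} {v : ℝ} (hf : DifferentiableAt ℝ f v)
    (hh : DifferentiableAt ℝ h v) (θ : ℝ) (a : ℝ × ℝ) :
    fderiv ℝ (revolve f h) (v, θ) a =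
      !₂[deriv f v * Real.cos θ * a.1 - f v * Real.sin θ * a.2,
        deriv f v * Real.sin θ * a.1 + f v * Real.cos θ * a.2, deriv h v * a.1] := by
  have hX := (differentiableAt_revolve hf hh θ).hasFDerivAt
  have hf' : HasFDerivAt (fun p : ℝ × ℝ => f p.1) _ (v, θ) :=
    HasDerivAt.comp_hasFDerivAt (h₂ := f) (f := fun p : ℝ × ℝ => p.1) (v, θ) hf.hasDerivAt
      (hasFDerivAt_fst (𝕜 := ℝ) (E := ℝ) (F := ℝ))
  have hh' : HasFDerivAt (fun p : ℝ × ℝ => h p.1) _ (v, θ) :=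
    HasDerivAt.comp_hasFDerivAt (h₂ := h) (f := fun p : ℝ × ℝ => p.1) (v, θ) hh.hasDerivAt
      (hasFDerivAt_fst (𝕜 := ℝ) (E := ℝ) (F := ℝ))
  have hs : HasFDerivAt (fun p : ℝ × ℝ => p.2) _ (v, θ) :=
    hasFDerivAt_snd (𝕜 := ℝ) (E := ℝ) (F := ℝ)
  have hc (i : Fin 3) : HasFDerivAt (fun p => revolve f h p i)
      (PiLp.proj 2 (fun _ : Fin 3 => ℝ) i ∘L fderiv ℝ (revolve f h) (v, θ)) (v, θ) :=
    HasFDerivAt.comp (g := fun y : E3 => y i) (v, θ)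
      (PiLp.proj (𝕜 := ℝ) 2 (fun _ : Fin 3 => ℝ) i).hasFDerivAt hX
  ext i
  fin_cases i
  · change (PiLp.proj 2 (fun _ : Fin 3 => ℝ) 0 ∘L fderiv ℝ (revolve f h) (v, θ)) a = _
    rw [(hc 0).unique (hf'.mul hs.cos)]
    simp; ring
  · change (PiLp.proj 2 (fun _ : Fin 3 => ℝ) 1 ∘L fderiv ℝ (revolve f h) (v, θ)) a = _
    rw [(hc 1).unique (hf'.mul hs.sin)]
    simp; ring
  · change (PiLp.proj 2 (fun _ : Fin 3 => ℝ) 2 ∘L fderiv ℝ (revolve f h) (v, θ)) a = _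
    rw [(hc 2).unique hh']
    simp

/-- The metric of a surface of revolution is `(f'² + h'²) dv² + f² dθ²`. -/
theorem inducedMetric_revolve {f h : ℝ → ℝ} {v : ℝ} (hf : DifferentiableAt ℝ f v)
    (hh : DifferentiableAt ℝ h v) (θ : ℝ) (a b : ℝ × ℝ) :
    inducedMetric (revolve f h) (v, θ) a b =
      (deriv f v ^ 2 + deriv h v ^ 2) * (a.1 * b.1) + f v ^ 2 * (a.2 * b.2) := by
  rw [inducedMetric, fderiv_revolve_apply hf hh, fderiv_revolve_apply hf hh]
  simp only [PiLp.inner_apply, Fin.sum_univ_three, RCLike.inner_apply, conj_trivial]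
  simp only [Matrix.cons_val]
  linear_combination (deriv f v ^ 2 * a.1 * b.1 + f v ^ 2 * a.2 * b.2) *
    Real.cos_sq_add_sin_sq θ

/-! ### Regularity of the profile off the poles -/

section Profile

variable {I : Set ℝ} {f h : ℝ → ℝ}

theorem IsImmersedRevolution.contDiffAt_radius (hS : IsImmersedRevolution I f h) {v : ℝ}
    (hv : v ∈ nonPoles I f) : ContDiffAt ℝ ∞ f v := by
  have h1 := contDiffAt_euclidean.1 ((hS.regular v hv).2 0).1 0
  have h2 : ContDiffAt ℝ ∞ (fun x : ℝ => (x, (0 : ℝ))) v := by fun_prop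
  simpa [revolve, Function.comp_def] using ContDiffAt.comp v h1 h2

theorem IsImmersedRevolution.contDiffAt_height (hS : IsImmersedRevolution I f h) {v : ℝ}
    (hv : v ∈ nonPoles I f) : ContDiffAt ℝ ∞ h v := by
  have h1 := contDiffAt_euclidean.1 ((hS.regular v hv).2 0).1 2
  have h2 : ContDiffAt ℝ ∞ (fun x : ℝ => (x, (0 : ℝ))) v := by fun_prop
  simpa [revolve, Function.comp_def] using ContDiffAt.comp v h1 h2

theorem IsImmersedRevolution.speed_pos (hS : IsImmersedRevolution I f h) {v : ℝ}
    (hv : v ∈ nonPoles I f) : 0 < deriv f v ^ 2 + deriv h v ^ 2 := by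
  have hf := (hS.contDiffAt_radius hv).differentiableAt (by simp)
  have hh := (hS.contDiffAt_height hv).differentiableAt (by simp)
  -- The squared length of the meridian tangent `(1, 0)` is `f'² + h'²`.
  have hne : fderiv ℝ (revolve f h) (v, 0) (1, 0) ≠ 0 := fun h0 => by
    simpa using ((hS.regular v hv).2 0).2 (h0.trans (map_zero _).symm)
  have hm := inducedMetric_revolve hf hh 0 (1, 0) (1, 0)
  rw [inducedMetric, real_inner_self_eq_norm_sq] at hm
  have := pow_pos (norm_pos_iff.2 hne) 2
  simp at hm
  linarith

/-- A pole is an endpoint of the parameter interval. -/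
theorem IsImmersedRevolution.ne_zero_of_between (hS : IsImmersedRevolution I f h) {x p y : ℝ}
    (hx : x ∈ I) (hy : y ∈ I) (hxp : x < p) (hpy : p < y) : f p ≠ 0 := by
  intro h0
  obtain ⟨σ, ε, hσ, hε, hI, -⟩ := hS.pole p (hS.interval.out hx hy ⟨hxp.le, hpy.le⟩) h0
  rcases hσ with rfl | rfl
  -- With `σ = 1` nothing of `I` near `p` lies to its left, yet `I` contains all of `[x, p]`. The
  -- case `σ = -1` is the mirror image.
  · obtain ⟨z, hz1, hz2⟩ := exists_between (max_lt hxp (sub_lt_self p hε))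
    rw [max_lt_iff] at hz1
    have hz : z ∈ I ∩ Ioo (p - ε) (p + ε) :=
      ⟨hS.interval.out hx hy ⟨hz1.1.le, by linarith⟩, hz1.2, by linarith⟩
    rw [hI] at hz
    obtain ⟨r, hr, rfl⟩ := hz
    have := hr.1
    simp only at hz2
    linarith
  · obtain ⟨z, hz1, hz2⟩ := exists_between (lt_min hpy (lt_add_of_pos_right p hε))
    rw [lt_min_iff] at hz2
    have hz : z ∈ I ∩ Ioo (p - ε) (p + ε) :=
      ⟨hS.interval.out hx hy ⟨by linarith, hz2.1.le⟩, by linarith, hz2.2⟩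
    rw [hI] at hz
    obtain ⟨r, hr, rfl⟩ := hz
    have := hr.1
    simp only at hz1
    linarith

theorem IsImmersedRevolution.isOpen_nonPoles (hS : IsImmersedRevolution I f h) :
    IsOpen (nonPoles I f) := by
  refine isOpen_iff_mem_nhds.2 fun v hv => ?_
  filter_upwards [mem_interior_iff_mem_nhds.1 (hS.regular v hv).1,
    (hS.contDiffAt_radius hv).continuousAt.eventually_ne hv.2] with x h1 h2 using ⟨h1, h2⟩

theorem IsImmersedRevolution.mem_nonPoles_of_between (hS : IsImmersedRevolution I f h)
    {x p y : ℝ} (hx : x ∈ I) (hy : y ∈ I) (hxp : x < p) (hpy : p < y) : p ∈ nonPoles I f :=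
  ⟨hS.interval.out hx hy ⟨hxp.le, hpy.le⟩, hS.ne_zero_of_between hx hy hxp hpy⟩

theorem IsImmersedRevolution.ordConnected_nonPoles (hS : IsImmersedRevolution I f h) :
    OrdConnected (nonPoles I f) := by
  refine ⟨fun x hx y hy z hz => ?_⟩
  rcases hz.1.eq_or_lt with rfl | h1
  · exact hx
  rcases hz.2.eq_or_lt with rfl | h2
  · exact hy
  exact hS.mem_nonPoles_of_between hx.1 hy.1 h1 h2

end Profile

/-! ### Comparison of increments -/

/-- Both `k - g` and `k + g` are monotone. It is applied with `k` a multiple of `ξ` and `g` one of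
`log f`, `f`, `h`. -/
theorem abs_sub_le_of_abs_deriv_le {s : Set ℝ} (hs : s.OrdConnected) {g k g' k' : ℝ → ℝ}
    (hg : ∀ x ∈ s, HasDerivAt g (g' x) x) (hk : ∀ x ∈ s, HasDerivAt k (k' x) x)
    (hle : ∀ x ∈ s, |g' x| ≤ k' x) {x y : ℝ} (hx : x ∈ s) (hy : y ∈ s) :
    |g x - g y| ≤ |k x - k y| := by
  have hc : Convex ℝ s := hs.convex
  have h1 : MonotoneOn (fun z => k z - g z) s := by
    refine monotoneOn_of_hasDerivWithinAt_nonneg hc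
      (fun z hz => ((hk z hz).sub (hg z hz)).continuousAt.continuousWithinAt)
      (fun z hz => ((hk z (interior_subset hz)).sub (hg z (interior_subset hz))).hasDerivWithinAt)
      (fun z hz => ?_)
    have := (abs_le.1 (hle z (interior_subset hz))).2
    linarith
  have h2 : MonotoneOn (fun z => k z + g z) s := by
    refine monotoneOn_of_hasDerivWithinAt_nonneg hc
      (fun z hz => ((hk z hz).add (hg z hz)).continuousAt.continuousWithinAt)
      (fun z hz => ((hk z (interior_subset hz)).add (hg z (interior_subset hz))).hasDerivWithinAt)
      (fun z hz => ?_)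
    have := (abs_le.1 (hle z (interior_subset hz))).1
    linarith
  wlog hxy : x ≤ y generalizing x y
  · rw [abs_sub_comm, abs_sub_comm (k x)]
    exact this hy hx (le_of_not_ge hxy)
  have e1 := h1 hx hy hxy
  have e2 := h2 hx hy hxy
  simp only at e1 e2
  rw [abs_sub_comm (k x)]
  exact (abs_le.2 ⟨by linarith, by linarith⟩).trans (le_abs_self _)

theorem eVariationOn_le_of_edist_le {α E F : Type*} [LinearOrder α] [PseudoEMetricSpace E]
    [PseudoEMetricSpace F] {g : α → E} {k : α → F} {s : Set α}
    (hle : ∀ x ∈ s, ∀ y ∈ s, edist (g x) (g y) ≤ edist (k x) (k y)) :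
    eVariationOn g s ≤ eVariationOn k s := by
  refine iSup_le fun p => le_iSup_of_le p (Finset.sum_le_sum fun i _ => ?_)
  exact hle _ (p.2.2.2 _) _ (p.2.2.2 _)

/-! ### The profile as seen in space -/

theorem revolveAngle_sub_norm_sq (f h : ℝ → ℝ) (x y : ℝ × Real.Angle) :
    ‖revolveAngle f h x - revolveAngle f h y‖ ^ 2 =
      (f x.1 * x.2.cos - f y.1 * y.2.cos) ^ 2 + (f x.1 * x.2.sin - f y.1 * y.2.sin) ^ 2 +
        (h x.1 - h y.1) ^ 2 := by
  simp [EuclideanSpace.norm_sq_eq, Fin.sum_univ_three, revolveAngle]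

/-- A nonnegative radius is the distance to the axis, which is 1-Lipschitz; in coordinates this is
Cauchy–Schwarz for the unit vectors at the two angles. -/
theorem abs_radius_sub_le {f : ℝ → ℝ} (h : ℝ → ℝ) {x y : ℝ × Real.Angle} (hx : 0 ≤ f x.1)
    (hy : 0 ≤ f y.1) :
    |f x.1 - f y.1| ≤ dist (revolveAngle f h x) (revolveAngle f h y) := by
  rw [dist_eq_norm]
  refine abs_le_of_sq_le_sq ?_ (norm_nonneg _)
  rw [revolveAngle_sub_norm_sq]
  have hxy := mul_nonneg hx hy
  have e1 := x.2.cos_sq_add_sin_sq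
  have e2 := y.2.cos_sq_add_sin_sq
  have hle : x.2.cos * y.2.cos + x.2.sin * y.2.sin ≤ 1 := by
    nlinarith [sq_nonneg (x.2.cos - y.2.cos), sq_nonneg (x.2.sin - y.2.sin)]
  have e3 : (f x.1 * x.2.cos - f y.1 * y.2.cos) ^ 2 + (f x.1 * x.2.sin - f y.1 * y.2.sin) ^ 2 =
      f x.1 ^ 2 + f y.1 ^ 2 - 2 * (f x.1 * f y.1) * (x.2.cos * y.2.cos + x.2.sin * y.2.sin) := by
    linear_combination f x.1 ^ 2 * e1 + f y.1 ^ 2 * e2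
  rw [e3]
  nlinarith [sq_nonneg (h x.1 - h y.1), mul_le_mul_of_nonneg_left hle hxy]

theorem abs_height_sub_le (f h : ℝ → ℝ) (x y : ℝ × Real.Angle) :
    |h x.1 - h y.1| ≤ dist (revolveAngle f h x) (revolveAngle f h y) := by
  rw [dist_eq_norm]
  refine abs_le_of_sq_le_sq ?_ (norm_nonneg _)
  rw [revolveAngle_sub_norm_sq]
  exact le_add_of_nonneg_left (by positivity)

theorem dist_revolveAngle_meridian_le (f h : ℝ → ℝ) (x y : ℝ) :
    dist (revolveAngle f h (x, 0)) (revolveAngle f h (y, 0)) ≤ |f x - f y| + |h x - h y| := by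
  rw [dist_eq_norm]
  refine le_of_sq_le_sq ?_ (by positivity)
  rw [revolveAngle_sub_norm_sq]
  simp
  nlinarith [sq_abs (f x - f y), sq_abs (h x - h y),
    mul_nonneg (abs_nonneg (f x - f y)) (abs_nonneg (h x - h y))]

/-! ### The coordinate `ξ` and the estimates it controls. -/

section Xi

variable {I : Set ℝ} {f h : ℝ → ℝ} {q : ℝ}

theorem IsImmersedRevolution.contDiffOn_xiIntegrand (hS : IsImmersedRevolution I f h) :
    ContDiffOn ℝ ∞ (xiIntegrand f h) (nonPoles I f) := by
  have hf : ContDiffOn ℝ ∞ f (nonPoles I f) :=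
    fun v hv => (hS.contDiffAt_radius hv).contDiffWithinAt
  have hh : ContDiffOn ℝ ∞ h (nonPoles I f) :=
    fun v hv => (hS.contDiffAt_height hv).contDiffWithinAt
  have hf' := hf.deriv_of_isOpen (m := ∞) hS.isOpen_nonPoles le_rfl
  have hh' := hh.deriv_of_isOpen (m := ∞) hS.isOpen_nonPoles le_rfl
  exact (((hf'.pow 2).add (hh'.pow 2)).sqrt fun v hv => (hS.speed_pos hv).ne').div hf
    fun v hv => hv.2

theorem IsImmersedRevolution.intervalIntegrable_xiIntegrand (hS : IsImmersedRevolution I f h)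
    (hq : q ∈ nonPoles I f) {v : ℝ} (hv : v ∈ nonPoles I f) :
    IntervalIntegrable (xiIntegrand f h) volume q v :=
  (hS.contDiffOn_xiIntegrand.continuousOn.mono
    (hS.ordConnected_nonPoles.uIcc_subset hq hv)).intervalIntegrable

theorem IsImmersedRevolution.hasDerivAt_xi (hS : IsImmersedRevolution I f h)
    (hq : q ∈ nonPoles I f) {v : ℝ} (hv : v ∈ nonPoles I f) :
    HasDerivAt (xi f h q) (xiIntegrand f h v) v :=
  intervalIntegral.integral_hasDerivAt_right (hS.intervalIntegrable_xiIntegrand hq hv)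
    (hS.contDiffOn_xiIntegrand.continuousOn.stronglyMeasurableAtFilter hS.isOpen_nonPoles v hv)
    (hS.contDiffOn_xiIntegrand.continuousOn.continuousAt (hS.isOpen_nonPoles.mem_nhds hv))

theorem IsImmersedRevolution.contDiffOn_xi (hS : IsImmersedRevolution I f h)
    (hq : q ∈ nonPoles I f) : ContDiffOn ℝ ∞ (xi f h q) (nonPoles I f) := by
  rw [contDiffOn_infty_iff_deriv_of_isOpen hS.isOpen_nonPoles]
  exact ⟨fun v hv => (hS.hasDerivAt_xi hq hv).differentiableAt.differentiableWithinAt,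
    hS.contDiffOn_xiIntegrand.congr fun v hv => (hS.hasDerivAt_xi hq hv).deriv⟩

theorem xi_self (f h : ℝ → ℝ) (q : ℝ) : xi f h q q = 0 := intervalIntegral.integral_same

theorem IsImmersedRevolution.xiIntegrand_pos (hS : IsImmersedRevolution I f h)
    (hnonneg : ∀ v ∈ I, 0 ≤ f v) {v : ℝ} (hv : v ∈ nonPoles I f) : 0 < xiIntegrand f h v :=
  div_pos (Real.sqrt_pos.2 (hS.speed_pos hv)) ((hnonneg v hv.1).lt_of_ne' hv.2)

theorem IsImmersedRevolution.strictMonoOn_xi (hS : IsImmersedRevolution I f h)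
    (hnonneg : ∀ v ∈ I, 0 ≤ f v) (hq : q ∈ nonPoles I f) :
    StrictMonoOn (xi f h q) (nonPoles I f) := by
  refine strictMonoOn_of_hasDerivWithinAt_pos hS.ordConnected_nonPoles.convex
    (hS.contDiffOn_xi hq).continuousOn
    (fun v hv => (hS.hasDerivAt_xi hq (interior_subset hv)).hasDerivWithinAt)
    (fun v hv => hS.xiIntegrand_pos hnonneg (interior_subset hv))

/-- The logarithm of the radius varies at most as fast as `ξ`. -/
theorem IsImmersedRevolution.abs_log_sub_le (hS : IsImmersedRevolution I f h)
    (hnonneg : ∀ v ∈ I, 0 ≤ f v) (hq : q ∈ nonPoles I f) {v : ℝ} (hv : v ∈ nonPoles I f) :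
    |Real.log (f v) - Real.log (f q)| ≤ |xi f h q v| := by
  have := abs_sub_le_of_abs_deriv_le (g := fun x => Real.log (f x)) hS.ordConnected_nonPoles
    (fun x hx => (((hS.contDiffAt_radius hx).differentiableAt (by simp)).hasDerivAt.log hx.2))
    (fun x hx => hS.hasDerivAt_xi hq hx) (fun x hx => ?_) hv hq
  · simpa [xi_self] using this
  · have hpos := (hnonneg x hx.1).lt_of_ne' hx.2
    rw [xiIntegrand, abs_div, abs_of_pos hpos]
    gcongr
    exact Real.abs_le_sqrt (by nlinarith [sq_nonneg (deriv h x)])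

/-- A bound on `|ξ|` at two parameters holds between them. -/
theorem IsImmersedRevolution.abs_xi_le_of_mem_uIcc (hS : IsImmersedRevolution I f h)
    (hnonneg : ∀ v ∈ I, 0 ≤ f v) (hq : q ∈ nonPoles I f) {M x y z : ℝ}
    (hx : x ∈ nonPoles I f) (hy : y ∈ nonPoles I f)
    (hxM : |xi f h q x| ≤ M) (hyM : |xi f h q y| ≤ M) (hz : z ∈ uIcc x y) :
    |xi f h q z| ≤ M := by
  have hmono := (hS.strictMonoOn_xi hnonneg hq).monotoneOn
  have hzJ := hS.ordConnected_nonPoles.uIcc_subset hx hy hz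
  rw [abs_le] at hxM hyM ⊢
  rcases le_total x y with hxy | hxy
  · rw [uIcc_of_le hxy] at hz
    exact ⟨hxM.1.trans (hmono hx hzJ hz.1), (hmono hzJ hy hz.2).trans hyM.2⟩
  · rw [uIcc_of_ge hxy] at hz
    exact ⟨hyM.1.trans (hmono hy hzJ hz.1), (hmono hzJ hx hz.2).trans hxM.2⟩

/-- Where `|ξ| ≤ M`, the profile is Lipschitz in `ξ`. -/
theorem IsImmersedRevolution.abs_profile_sub_le (hS : IsImmersedRevolution I f h)
    (hnonneg : ∀ v ∈ I, 0 ≤ f v) (hq : q ∈ nonPoles I f) {M x y : ℝ}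
    (hx : x ∈ nonPoles I f) (hy : y ∈ nonPoles I f)
    (hxM : |xi f h q x| ≤ M) (hyM : |xi f h q y| ≤ M) :
    |f x - f y| ≤ f q * Real.exp M * |xi f h q x - xi f h q y| ∧
      |h x - h y| ≤ f q * Real.exp M * |xi f h q x - xi f h q y| := by
  have hJ := hS.ordConnected_nonPoles.uIcc_subset hx hy
  have hfq := (hnonneg q hq.1).lt_of_ne' hq.2
  have hbound : ∀ z ∈ uIcc x y,
      Real.sqrt (deriv f z ^ 2 + deriv h z ^ 2) ≤ f q * Real.exp M * xiIntegrand f h z := by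
    intro z hz
    have hzJ := hJ hz
    have hfz := (hnonneg z hzJ.1).lt_of_ne' hzJ.2
    have hzM := hS.abs_xi_le_of_mem_uIcc hnonneg hq hx hy hxM hyM hz
    have hlog := (abs_le.1 ((hS.abs_log_sub_le hnonneg hq hzJ).trans hzM)).2
    -- The Lipschitz constant is this bound on the radius, since the speed of the profile is `f`
    -- times `ξ'`.
    have hfle : f z ≤ f q * Real.exp M := by
      rw [← Real.exp_log hfz, ← Real.exp_log hfq, ← Real.exp_add]
      exact Real.exp_le_exp.2 (by linarith)
    calc Real.sqrt (deriv f z ^ 2 + deriv h z ^ 2) = f z * xiIntegrand f h z := by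
          rw [xiIntegrand, mul_div_cancel₀ _ hfz.ne']
      _ ≤ _ := mul_le_mul_of_nonneg_right hfle (hS.xiIntegrand_pos hnonneg hzJ).le
  have hk : ∀ z ∈ uIcc x y, HasDerivAt (fun z => f q * Real.exp M * xi f h q z)
      (f q * Real.exp M * xiIntegrand f h z) z :=
    fun z hz => (hS.hasDerivAt_xi hq (hJ hz)).const_mul _
  have heq : |f q * Real.exp M * xi f h q x - f q * Real.exp M * xi f h q y| =
      f q * Real.exp M * |xi f h q x - xi f h q y| := by
    rw [← mul_sub, abs_mul, abs_of_pos (by positivity)]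
  rw [← heq]
  constructor
  · refine abs_sub_le_of_abs_deriv_le ordConnected_uIcc
      (fun z hz => ((hS.contDiffAt_radius (hJ hz)).differentiableAt (by simp)).hasDerivAt)
      hk (fun z hz => le_trans (Real.abs_le_sqrt ?_) (hbound z hz)) left_mem_uIcc right_mem_uIcc
    nlinarith [sq_nonneg (deriv h z)]
  · refine abs_sub_le_of_abs_deriv_le ordConnected_uIcc
      (fun z hz => ((hS.contDiffAt_height (hJ hz)).differentiableAt (by simp)).hasDerivAt)
      hk (fun z hz => le_trans (Real.abs_le_sqrt ?_) (hbound z hz)) left_mem_uIcc right_mem_uIcc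
    nlinarith [sq_nonneg (deriv f z)]

/-! ### The intrinsic distance -/

/-- The segment of a meridian between two parameters. -/
noncomputable def meridianPath (hI : I.OrdConnected) (x y : I) : Path (x, (0 : Real.Angle)) (y, 0) where
  toFun s := (⟨AffineMap.lineMap (x : ℝ) (y : ℝ) (s : ℝ), hI.uIcc_subset x.2 y.2
    (by rw [← segment_eq_uIcc, segment_eq_image_lineMap]; exact ⟨s, s.2, rfl⟩)⟩, 0)
  continuous_toFun := by
    refine Continuous.prodMk (Continuous.subtype_mk ?_ _) continuous_const
    exact AffineMap.lineMap_continuous.comp continuous_subtype_val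
  source' := by ext <;> simp
  target' := by ext <;> simp

/-- The meridian segment is a competitor in the infimum, and its length is at most the variation of
the monotone function `C * ξ` along it. The factor 2 comes from adding the increments of radius and
height. -/
theorem IsImmersedRevolution.intrinsicEDist_meridian_le (hS : IsImmersedRevolution I f h)
    (hnonneg : ∀ v ∈ I, 0 ≤ f v) (hq : q ∈ nonPoles I f) {M : ℝ} {x y : I}
    (hx : (x : ℝ) ∈ nonPoles I f) (hy : (y : ℝ) ∈ nonPoles I f)
    (hxM : |xi f h q x| ≤ M) (hyM : |xi f h q y| ≤ M) :
    intrinsicEDist I f h (x, 0) (y, 0) ≤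
      ENNReal.ofReal (2 * (f q * Real.exp M) * |xi f h q x - xi f h q y|) := by
  have hmono := (hS.strictMonoOn_xi hnonneg hq).monotoneOn
  have hfq := (hnonneg q hq.1).lt_of_ne' hq.2
  have hJ := hS.ordConnected_nonPoles.uIcc_subset hx hy
  set C := 2 * (f q * Real.exp M) with hC
  have hC0 : 0 ≤ C := by positivity
  set c : unitInterval → ℝ := fun s => AffineMap.lineMap (x : ℝ) (y : ℝ) (s : ℝ) with hc
  have hcmem : ∀ s, c s ∈ uIcc (x : ℝ) y := fun s => by
    rw [← segment_eq_uIcc, segment_eq_image_lineMap]; exact ⟨s, s.2, rfl⟩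
  have hcM : ∀ s, |xi f h q (c s)| ≤ M := fun s =>
    hS.abs_xi_le_of_mem_uIcc hnonneg hq hx hy hxM hyM (hcmem s)
  refine (iInf_le _ (meridianPath hS.interval x y)).trans ?_
  have hle : eVariationOn (fun s => revolveAngle f h
      (((meridianPath hS.interval x y s).1 : ℝ), (meridianPath hS.interval x y s).2)) univ ≤
      eVariationOn (fun s => C * xi f h q (c s)) univ := by
    refine eVariationOn_le_of_edist_le fun s _ t _ => ?_
    rw [edist_dist, edist_dist]
    refine ENNReal.ofReal_le_ofReal ?_
    change dist (revolveAngle f h (c s, 0)) (revolveAngle f h (c t, 0)) ≤ _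
    obtain ⟨e1, e2⟩ := hS.abs_profile_sub_le hnonneg hq (hJ (hcmem s)) (hJ (hcmem t))
      (hcM s) (hcM t)
    refine (dist_revolveAngle_meridian_le f h _ _).trans ?_
    rw [Real.dist_eq, ← mul_sub, abs_mul, abs_of_nonneg hC0]
    linarith
  refine hle.trans ?_
  have h0 : c 0 = x := by simp [hc]
  have h1 : c 1 = y := by simp [hc]
  -- This is the shape in which `MonotoneOn.eVariationOn_eq` evaluates a variation.
  have huniv : (univ : Set unitInterval) = univ ∩ Icc 0 1 := by
    have hs : ∀ s : unitInterval, s ∈ Icc 0 1 := fun s => ⟨s.2.1, s.2.2⟩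
    rw [univ_inter, eq_univ_of_forall hs]
  rw [huniv]
  rcases le_total (x : ℝ) y with hxy | hxy
  · have hm : MonotoneOn (fun s => C * xi f h q (c s)) univ := fun s _ t _ hst =>
      mul_le_mul_of_nonneg_left (hmono (hJ (hcmem s)) (hJ (hcmem t))
        (AffineMap.lineMap_mono hxy hst)) hC0
    refine (hm.eVariationOn_eq (mem_univ _) (mem_univ _)).le.trans (ENNReal.ofReal_le_ofReal ?_)
    rw [h0, h1, ← mul_sub, abs_sub_comm]
    exact mul_le_mul_of_nonneg_left (le_abs_self _) hC0
  · have hm : MonotoneOn (fun s => -(C * xi f h q (c s))) univ := fun s _ t _ hst =>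
      neg_le_neg (mul_le_mul_of_nonneg_left (hmono (hJ (hcmem t)) (hJ (hcmem s))
        (AffineMap.lineMap_anti hxy hst)) hC0)
    have hneg : eVariationOn (fun s => C * xi f h q (c s)) (univ ∩ Icc 0 1) ≤
        eVariationOn (fun s => -(C * xi f h q (c s))) (univ ∩ Icc 0 1) :=
      eVariationOn_le_of_edist_le fun s _ t _ => (edist_neg_neg _ _).ge
    refine hneg.trans ((hm.eVariationOn_eq (mem_univ _) (mem_univ _)).le.trans
      (ENNReal.ofReal_le_ofReal ?_))
    rw [h0, h1, neg_sub_neg, ← mul_sub]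
    exact mul_le_mul_of_nonneg_left (le_abs_self _) hC0

/-- The intrinsic distance bounds the difference of the radii. -/
theorem ofReal_abs_radius_sub_le_intrinsicEDist (hnonneg : ∀ v ∈ I, 0 ≤ f v)
    (x y : I × Real.Angle) :
    ENNReal.ofReal |f x.1 - f y.1| ≤ intrinsicEDist I f h x y := by
  refine le_iInf fun γ => ?_
  have := eVariationOn.edist_le (fun s => revolveAngle f h (((γ s).1 : ℝ), (γ s).2))
    (mem_univ 0) (mem_univ 1)
  refine le_trans ?_ this
  simp only [γ.source, γ.target]
  rw [edist_dist]
  exact ENNReal.ofReal_le_ofReal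
    (abs_radius_sub_le h (hnonneg _ x.1.2) (hnonneg _ y.1.2) (x := (x.1, x.2)) (y := (y.1, y.2)))

/-- A path passes every parameter between those of its endpoints. -/
theorem ofReal_abs_profile_sub_le_intrinsicEDist (hnonneg : ∀ v ∈ I, 0 ≤ f v)
    (x y : I × Real.Angle) {u v : ℝ} (hu : u ∈ uIcc (x.1 : ℝ) y.1) (hv : v ∈ uIcc (x.1 : ℝ) y.1) :
    ENNReal.ofReal (max |f u - f v| |h u - h v|) ≤ intrinsicEDist I f h x y := by
  refine le_iInf fun γ => ?_
  have hcont : Continuous fun s => ((γ s).1 : ℝ) :=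
    continuous_subtype_val.comp (continuous_fst.comp γ.continuous)
  -- Intermediate value theorem for the parameter along the path.
  have hpass : uIcc (x.1 : ℝ) y.1 ⊆ range fun s => ((γ s).1 : ℝ) := by
    refine (isPreconnected_range hcont).ordConnected.uIcc_subset ⟨0, ?_⟩ ⟨1, ?_⟩ <;> simp
  obtain ⟨s, rfl⟩ := hpass hu
  obtain ⟨t, rfl⟩ := hpass hv
  refine le_trans ?_ (eVariationOn.edist_le (fun s => revolveAngle f h (((γ s).1 : ℝ), (γ s).2))
    (mem_univ s) (mem_univ t))
  rw [edist_dist]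
  refine ENNReal.ofReal_le_ofReal (max_le ?_ ?_)
  · exact abs_radius_sub_le h (hnonneg _ (γ s).1.2) (hnonneg _ (γ t).1.2)
      (x := ((γ s).1, (γ s).2)) (y := ((γ t).1, (γ t).2))
  · exact abs_height_sub_le f h ((γ s).1, (γ s).2) ((γ t).1, (γ t).2)

end Xi

/-! ### Surjectivity of `ξ` from completeness. -/

section Range

variable {I : Set ℝ} {f h : ℝ → ℝ} {q : ℝ}

/-- A profile constant between `a` and `b` would have zero speed at an interior point. The positive
gap bounds from below the length of any path crossing from `a` to `b`. -/
theorem IsImmersedRevolution.exists_profile_ne (hS : IsImmersedRevolution I f h) {a b : ℝ}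
    (ha : a ∈ nonPoles I f) (hb : b ∈ nonPoles I f) (hab : a ≠ b) :
    ∃ u ∈ uIcc a b, 0 < max |f u - f a| |h u - h a| := by
  by_contra! hcon
  have hcon' : ∀ u ∈ uIcc a b, f u = f a ∧ h u = h a := fun u hu => by
    have := max_le_iff.1 (hcon u hu)
    exact ⟨sub_eq_zero.1 (abs_nonpos_iff.1 this.1), sub_eq_zero.1 (abs_nonpos_iff.1 this.2)⟩
  have hlt : min a b < max a b := min_lt_max.2 hab
  obtain ⟨m, hm⟩ := exists_between hlt
  have hmJ := hS.ordConnected_nonPoles.uIcc_subset ha hb ⟨hm.1.le, hm.2.le⟩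
  have hnhds : ∀ᶠ u in 𝓝 m, u ∈ uIcc a b := Icc_mem_nhds hm.1 hm.2
  have hf : deriv f m = 0 := by
    rw [EventuallyEq.deriv_eq (f := fun _ => f a) (hnhds.mono fun u hu => (hcon' u hu).1),
      deriv_const]
  have hh : deriv h m = 0 := by
    rw [EventuallyEq.deriv_eq (f := fun _ => h a) (hnhds.mono fun u hu => (hcon' u hu).2),
      deriv_const]
  simpa [hf, hh] using hS.speed_pos hmJ

theorem IsImmersedRevolution.isOpen_image_xi (hS : IsImmersedRevolution I f h)
    (hnonneg : ∀ v ∈ I, 0 ≤ f v) (hq : q ∈ nonPoles I f) :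
    IsOpen (xi f h q '' nonPoles I f) := by
  refine isOpen_iff_mem_nhds.2 ?_
  rintro _ ⟨v, hv, rfl⟩
  have hd := ((hS.contDiffOn_xi hq).contDiffAt
    (hS.isOpen_nonPoles.mem_nhds hv)).hasStrictDerivAt' (hS.hasDerivAt_xi hq hv) (by simp)
  rw [← hd.map_nhds_eq (hS.xiIntegrand_pos hnonneg hv).ne']
  exact image_mem_map (hS.isOpen_nonPoles.mem_nhds hv)

/-- Parameters on a complete surface along which `ξ` converges converge off the poles. -/
theorem IsImmersedRevolution.exists_tendsto_of_tendsto_xi (hS : IsImmersedRevolution I f h)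
    (hcomplete : IsCompleteRevolution I f h) (hnonneg : ∀ v ∈ I, 0 ≤ f v)
    (hq : q ∈ nonPoles I f) {v : ℕ → ℝ} (hv : ∀ n, v n ∈ nonPoles I f) {x : ℝ}
    (hx : Tendsto (fun n => xi f h q (v n)) atTop (𝓝 x)) :
    ∃ w ∈ nonPoles I f, Tendsto v atTop (𝓝 w) := by
  obtain ⟨M, hM⟩ := hx.abs.bddAbove_range
  have hM : ∀ n, |xi f h q (v n)| ≤ M := fun n => hM ⟨n, rfl⟩
  have hfq := (hnonneg q hq.1).lt_of_ne' hq.2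
  obtain ⟨a, ha⟩ := hcomplete (fun n => (⟨v n, (hv n).1⟩, 0)) (by
    intro ε hε
    obtain ⟨δ, hδ0, hδ⟩ := ENNReal.lt_iff_exists_real_btwn.1 hε
    have hδ0' : 0 < δ := ENNReal.ofReal_pos.1 hδ.1
    have hC : 0 < 2 * (f q * Real.exp M) := by positivity
    obtain ⟨N, hN⟩ := Metric.cauchySeq_iff.1 hx.cauchySeq (δ / (2 * (f q * Real.exp M)))
      (div_pos hδ0' hC)
    refine ⟨N, fun m hm n hn => ?_⟩
    refine (hS.intrinsicEDist_meridian_le hnonneg hq (hv m) (hv n) (hM m) (hM n)).trans_lt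
      (lt_of_le_of_lt (ENNReal.ofReal_le_ofReal ?_) hδ.2)
    have := hN m hm n hn
    rw [Real.dist_eq, lt_div_iff₀ hC] at this
    linarith)
  obtain ⟨⟨w, hwI⟩, φ⟩ := a
  -- The radii `f (v n)` stay above `f q * exp (-M)`, so the points keep a positive intrinsic
  -- distance from any pole.
  have hwne : f w ≠ 0 := by
    intro hw0
    have hlow : ∀ n, f q * Real.exp (-M) ≤ f (v n) := fun n => by
      have hpos := (hnonneg _ (hv n).1).lt_of_ne' (hv n).2
      have := (abs_le.1 ((hS.abs_log_sub_le hnonneg hq (hv n)).trans (hM n))).1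
      rw [← Real.exp_log hpos, ← Real.exp_log hfq, ← Real.exp_add]
      exact Real.exp_le_exp.2 (by linarith)
    have hpos : 0 < ENNReal.ofReal (f q * Real.exp (-M)) :=
      ENNReal.ofReal_pos.2 (by positivity)
    obtain ⟨n, hn⟩ := (ha.eventually_lt_const hpos).exists
    refine hn.not_ge (le_trans (ENNReal.ofReal_le_ofReal ?_)
      (ofReal_abs_radius_sub_le_intrinsicEDist hnonneg _ _))
    simp only [hw0, sub_zero]
    exact (hlow n).trans (le_abs_self _)
  have hw : w ∈ nonPoles I f := ⟨hwI, hwne⟩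
  -- Turns intrinsic convergence into convergence of parameters: if `w'` separates `v n` from `w`,
  -- every connecting path traverses the profile from `w'` to `w`, at a fixed positive cost in
  -- length.
  have hcross : ∀ w' ∈ nonPoles I f, w' ≠ w → ∀ᶠ n in atTop, w' ∉ uIcc (v n) w := by
    intro w' hw' hne
    obtain ⟨u, hu, hpos⟩ := hS.exists_profile_ne hw' hw hne
    filter_upwards [ha.eventually_lt_const (ENNReal.ofReal_pos.2 hpos)] with n hn hmem
    refine hn.not_ge (ofReal_abs_profile_sub_le_intrinsicEDist hnonneg _ _ ?_ hmem)
    exact uIcc_subset_uIcc_right hmem hu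
  refine ⟨w, hw, tendsto_order.2 ⟨fun l hl => ?_, fun r hr => ?_⟩⟩
  · obtain ⟨l', hl', hsub⟩ := exists_Ioc_subset_of_mem_nhds
      (hS.isOpen_nonPoles.mem_nhds hw) ⟨l, hl⟩
    obtain ⟨z, hz1, hz2⟩ := exists_between (max_lt hl hl')
    rw [max_lt_iff] at hz1
    filter_upwards [hcross z (hsub ⟨hz1.2, hz2.le⟩) hz2.ne] with n hn
    by_contra! hle
    exact hn (mem_uIcc.2 (Or.inl ⟨hle.trans hz1.1.le, hz2.le⟩))
  · obtain ⟨r', hr', hsub⟩ := exists_Ico_subset_of_mem_nhds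
      (hS.isOpen_nonPoles.mem_nhds hw) ⟨r, hr⟩
    obtain ⟨z, hz1, hz2⟩ := exists_between (lt_min hr hr')
    rw [lt_min_iff] at hz2
    filter_upwards [hcross z (hsub ⟨hz1.le, hz2.2⟩) hz1.ne'] with n hn
    by_contra! hle
    exact hn (mem_uIcc.2 (Or.inr ⟨hz1.le, hz2.1.le.trans hle⟩))

/-- On a complete surface of revolution, `ξ` takes every real value. -/
theorem IsImmersedRevolution.image_xi_eq_univ (hS : IsImmersedRevolution I f h)
    (hcomplete : IsCompleteRevolution I f h) (hnonneg : ∀ v ∈ I, 0 ≤ f v)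
    (hq : q ∈ nonPoles I f) : xi f h q '' nonPoles I f = univ := by
  refine IsClopen.eq_univ ⟨?_, hS.isOpen_image_xi hnonneg hq⟩ ⟨_, q, hq, rfl⟩
  refine IsSeqClosed.isClosed fun u x hu hx => ?_
  choose v hv hvu using hu
  obtain rfl : (fun n => xi f h q (v n)) = u := funext hvu
  obtain ⟨w, hw, hlim⟩ := hS.exists_tendsto_of_tendsto_xi hcomplete hnonneg hq hv hx
  exact ⟨w, hw, tendsto_nhds_unique
    ((hS.hasDerivAt_xi hq hw).continuousAt.tendsto.comp hlim) hx⟩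

end Range

/-! ### The inverse function -/

/-- The inverse of a smooth injective function with non-vanishing derivative is smooth. -/
theorem contDiffAt_of_leftInverse_of_hasDerivAt {s : Set ℝ} (hs : IsOpen s) {g V : ℝ → ℝ}
    (hg : ContDiffOn ℝ ∞ g s) (hV : ∀ v ∈ s, V (g v) = v) {v g' : ℝ} (hv : v ∈ s)
    (hd : HasDerivAt g g' v) (hne : g' ≠ 0) :
    ContDiffAt ℝ ∞ V (g v) ∧ HasDerivAt V g'⁻¹ (g v) := by
  have hgv : ContDiffAt ℝ ∞ g v := hg.contDiffAt (hs.mem_nhds hv)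
  have hsd := hgv.hasStrictDerivAt' hd (by simp)
  -- Near `g v` the local inverse takes values in `s` and is a right inverse of `g`; applying the
  -- left inverse `V` identifies the two, so no continuity of `V` is needed beforehand.
  have hev : V =ᶠ[𝓝 (g v)] hsd.localInverse g g' v hne := by
    have hinv := hsd.to_localInverse hne
    have hlv : hsd.localInverse g g' v hne (g v) = v :=
      HasStrictFDerivAt.localInverse_apply_image _
    have hmem : ∀ᶠ y in 𝓝 (g v), hsd.localInverse g g' v hne y ∈ s :=
      hinv.hasDerivAt.continuousAt.eventually (by rw [hlv]; exact hs.mem_nhds hv)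
    have hr : ∀ᶠ y in 𝓝 (g v), g (hsd.localInverse g g' v hne y) = y :=
      HasStrictFDerivAt.eventually_right_inverse
        (hsd.hasStrictFDerivAt_equiv hne)
    filter_upwards [hmem, hr] with y h1 h2
    conv_lhs => rw [← h2]
    exact hV _ h1
  refine ⟨?_, (hsd.to_localInverse hne).hasDerivAt.congr_of_eventuallyEq hev⟩
  exact (hgv.to_localInverse (hd.hasFDerivAt_equiv hne) (by simp)).congr_of_eventuallyEq hev

theorem timeDomain_zero_mem {T : EReal} (hT : 0 < T) : (0 : ℝ) ∈ timeDomain T :=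
  ⟨le_rfl, by simpa using hT⟩

/-! ### The flow -/

section Flow

variable {I : Set ℝ} {T : EReal} {f h : ℝ → ℝ → ℝ}

/-- Only the slice at fixed `t` is taken because `t = 0` is a boundary point of the time domain. -/
theorem contDiffAt_slice {g : ℝ → ℝ → ℝ}
    (hg : ContDiffOn ℝ ∞ (fun z : ℝ × ℝ => g z.1 z.2) (I ×ˢ timeDomain T))
    {t : ℝ} (ht : t ∈ timeDomain T) {v : ℝ} (hv : I ∈ 𝓝 v) :
    ContDiffAt ℝ ∞ (fun x => g x t) v := by
  have hc : ContDiffOn ℝ ∞ (fun x : ℝ => (x, t)) I := by fun_prop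
  exact (hg.comp hc fun x hx => ⟨hx, ht⟩).contDiffAt hv

/-- The direction `(0, 1)` determines the conformal factor as the ratio of squared radii, and `(1,
0)` then compares the speeds; the product form eliminates the factor without division. -/
theorem IsConformalExtrinsicFlow.conformal_profile (hflow : IsConformalExtrinsicFlow I T f h)
    (hT : 0 < T) {t : ℝ} (ht : t ∈ timeDomain T) {v : ℝ} (hv : v ∈ nonPoles I fun v => f v 0) :
    (deriv (fun x => f x t) v ^ 2 + deriv (fun x => h x t) v ^ 2) * f v 0 ^ 2 =
      f v t ^ 2 * (deriv (fun x => f x 0) v ^ 2 + deriv (fun x => h x 0) v ^ 2) := by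
  have h0 := timeDomain_zero_mem hT
  have hI : I ∈ 𝓝 v := mem_interior_iff_mem_nhds.1 ((hflow.immersed 0 h0).regular v hv).1
  have hd {g : ℝ → ℝ → ℝ}
      (hg : ContDiffOn ℝ ∞ (fun z : ℝ × ℝ => g z.1 z.2) (I ×ˢ timeDomain T)) {s : ℝ}
      (hs : s ∈ timeDomain T) : DifferentiableAt ℝ (fun x => g x s) v :=
    (contDiffAt_slice hg hs hI).differentiableAt (by simp)
  obtain ⟨lam, hlam⟩ := hflow.conformal t ht
  have hm := (hlam v hv 0).2
  simp only [inducedMetric_revolve (hd hflow.smooth_f ht) (hd hflow.smooth_h ht),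
    inducedMetric_revolve (hd hflow.smooth_f h0) (hd hflow.smooth_h h0)] at hm
  have h1 := hm (1, 0) (1, 0)
  have h2 := hm (0, 1) (0, 1)
  simp only [mul_one, mul_zero, add_zero, zero_add] at h1 h2
  rw [h1, h2]
  ring

end Flow

/-! ### The main theorem. -/

theorem mainTheorem5 (I : Set ℝ) (T : EReal) (hT : 0 < T)
    (f₀ h₀ : ℝ → ℝ) (f h : ℝ → ℝ → ℝ)
    (hS₀ : IsImmersedRevolution I f₀ h₀)
    (hcomplete : IsCompleteRevolution I f₀ h₀)
    (hnonneg : ∀ v ∈ I, 0 ≤ f₀ v)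
    (hflow : IsConformalExtrinsicFlow I T f h)
    (hf₀ : ∀ v ∈ I, f v 0 = f₀ v) (hh₀ : ∀ v ∈ I, h v 0 = h₀ v)
    (q : ℝ) (hq : q ∈ I) (hfq : f₀ q ≠ 0) :
    -- the integral defining `ξ` converges off the poles, `ξ` is smooth there, its range is `ℝ`
    (∀ v ∈ nonPoles I f₀, IntervalIntegrable (xiIntegrand f₀ h₀) volume q v) ∧
    ContDiffOn ℝ ∞ (xi f₀ h₀ q) (nonPoles I f₀) ∧
    xi f₀ h₀ q '' nonPoles I f₀ = univ ∧
    -- `ξ` has a smooth inverse `V`, the same for all times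
    ∃ V : ℝ → ℝ, ContDiff ℝ ∞ V ∧
      (∀ x, V x ∈ nonPoles I f₀ ∧ xi f₀ h₀ q (V x) = x) ∧
      (∀ v ∈ nonPoles I f₀, V (xi f₀ h₀ q v) = v) ∧
      -- pole locations correspond to `ξ = -∞` or `ξ = ∞`
      (∀ p ∈ I, f₀ p = 0 →
        (p < q ∧ Tendsto (xi f₀ h₀ q) (𝓝[nonPoles I f₀] p) atBot ∧ Tendsto V atBot (𝓝 p)) ∨
        (q < p ∧ Tendsto (xi f₀ h₀ q) (𝓝[nonPoles I f₀] p) atTop ∧ Tendsto V atTop (𝓝 p))) ∧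
      -- the reparametrized flow `f(V(ξ), t)`, `h(V(ξ), t)`
      ContDiffOn ℝ ∞ (fun z : ℝ × ℝ => f (V z.1) z.2) (univ ×ˢ timeDomain T) ∧
      ContDiffOn ℝ ∞ (fun z : ℝ × ℝ => h (V z.1) z.2) (univ ×ˢ timeDomain T) ∧
      ∀ t ∈ timeDomain T, ∀ x : ℝ,
        deriv (fun y => f (V y) t) x ^ 2 + deriv (fun y => h (V y) t) x ^ 2 = f (V x) t ^ 2 ∧
        ∀ θ : ℝ, ∀ a b : ℝ × ℝ,
          inducedMetric (revolve (fun y => f (V y) t) (fun y => h (V y) t)) (x, θ) a b =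
            f (V x) t ^ 2 * (a.1 * b.1 + a.2 * b.2) := by
  have hqJ : q ∈ nonPoles I f₀ := ⟨hq, hfq⟩
  have hrange := hS₀.image_xi_eq_univ hcomplete hnonneg hqJ
  have hmono := hS₀.strictMonoOn_xi hnonneg hqJ
  refine ⟨fun v hv => hS₀.intervalIntegrable_xiIntegrand hqJ hv, hS₀.contDiffOn_xi hqJ,
    hrange, ?_⟩
  have hex : ∀ x, ∃ v ∈ nonPoles I f₀, xi f₀ h₀ q v = x := fun x => hrange.ge (mem_univ x)
  choose V hVJ hVx using hex
  have hVl : ∀ v ∈ nonPoles I f₀, V (xi f₀ h₀ q v) = v := fun v hv =>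
    hmono.injOn (hVJ _) hv (hVx _)
  have hVd : ∀ x, ContDiffAt ℝ ∞ V x ∧ HasDerivAt V (xiIntegrand f₀ h₀ (V x))⁻¹ x := fun x => by
    have := contDiffAt_of_leftInverse_of_hasDerivAt hS₀.isOpen_nonPoles (hS₀.contDiffOn_xi hqJ)
      hVl (hVJ x) (hS₀.hasDerivAt_xi hqJ (hVJ x)) (hS₀.xiIntegrand_pos hnonneg (hVJ x)).ne'
    rwa [hVx] at this
  have hVc : ContDiff ℝ ∞ V := contDiff_iff_contDiffAt.2 fun x => (hVd x).1
  have hlt : ∀ {v x}, v ∈ nonPoles I f₀ → v < V x → xi f₀ h₀ q v < x := fun {v x} hv hvx => by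
    simpa [hVx] using hmono hv (hVJ x) hvx
  have hgt : ∀ {v x}, v ∈ nonPoles I f₀ → V x < v → x < xi f₀ h₀ q v := fun {v x} hv hvx => by
    simpa [hVx] using hmono (hVJ x) hv hvx
  have hcomp : ContDiffOn ℝ ∞ (fun z : ℝ × ℝ => (V z.1, z.2)) (univ ×ˢ timeDomain T) :=
    ((hVc.comp contDiff_fst).prodMk contDiff_snd).contDiffOn
  have hmaps : MapsTo (fun z : ℝ × ℝ => (V z.1, z.2)) (univ ×ˢ timeDomain T)
      (I ×ˢ timeDomain T) := fun z hz => ⟨(hVJ z.1).1, hz.2⟩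
  refine ⟨V, hVc, fun x => ⟨hVJ x, hVx x⟩, hVl, fun p hp hp0 => ?_,
    hflow.smooth_f.comp hcomp hmaps, hflow.smooth_h.comp hcomp hmaps, fun t ht x => ?_⟩
  · have hpq : p ≠ q := fun e => hfq (e ▸ hp0)
    rcases hpq.lt_or_gt with hpq | hpq
    · have hside : ∀ v ∈ nonPoles I f₀, p < v := fun v hv => by
        by_contra! hle
        have hvp : v < p := hle.lt_of_ne fun e => hv.2 (e ▸ hp0)
        exact hS₀.ne_zero_of_between hv.1 hq hvp hpq hp0
      refine Or.inl ⟨hpq, tendsto_atBot.2 fun x => ?_, tendsto_order.2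
        ⟨fun l hl => Eventually.of_forall fun x => hl.trans (hside _ (hVJ x)), fun r hr => ?_⟩⟩
      -- Every level `x` is attained at `V x > p`, so `ξ < x` on the non-poles below `V x`. This is
      -- where surjectivity forces divergence.
      · filter_upwards [self_mem_nhdsWithin,
          mem_nhdsWithin_of_mem_nhds (Iio_mem_nhds (hside _ (hVJ x)))] with v hv hvx
        exact (hlt hv hvx).le
      -- Taking `z` below `q` as well places it between two points of `I`, hence off the poles; then
      -- `V x < z` once `x < ξ(z)`.
      · obtain ⟨z, hz1, hz2⟩ := exists_between (lt_min hr hpq)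
        rw [lt_min_iff] at hz2
        have hzJ := hS₀.mem_nonPoles_of_between hp hq hz1 hz2.2
        filter_upwards [eventually_lt_atBot (xi f₀ h₀ q z)] with x hx
        by_contra! hle
        exact lt_asymm hx (hlt hzJ (hz2.1.trans_le hle))
    · have hside : ∀ v ∈ nonPoles I f₀, v < p := fun v hv => by
        by_contra! hle
        have hvp : p < v := hle.lt_of_ne' fun e => hv.2 (e ▸ hp0)
        exact hS₀.ne_zero_of_between hq hv.1 hpq hvp hp0
      refine Or.inr ⟨hpq, tendsto_atTop.2 fun x => ?_, tendsto_order.2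
        ⟨fun l hl => ?_, fun r hr => Eventually.of_forall fun x => (hside _ (hVJ x)).trans hr⟩⟩
      · filter_upwards [self_mem_nhdsWithin,
          mem_nhdsWithin_of_mem_nhds (Ioi_mem_nhds (hside _ (hVJ x)))] with v hv hvx
        exact (hgt hv hvx).le
      · obtain ⟨z, hz1, hz2⟩ := exists_between (max_lt hl hpq)
        rw [max_lt_iff] at hz1
        have hzJ := hS₀.mem_nonPoles_of_between hq hp hz1.2 hz2
        filter_upwards [eventually_gt_atTop (xi f₀ h₀ q z)] with x hx
        by_contra! hle
        exact lt_asymm hx (hgt hzJ (hle.trans_lt hz1.1))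
  · have hI : I ∈ 𝓝 (V x) := mem_interior_iff_mem_nhds.1 (hS₀.regular _ (hVJ x)).1
    have hF := ((contDiffAt_slice hflow.smooth_f ht hI).differentiableAt (by simp)).hasDerivAt
    have hH := ((contDiffAt_slice hflow.smooth_h ht hI).differentiableAt (by simp)).hasDerivAt
    have hFV := hF.scomp x (hVd x).2
    have hHV := hH.scomp x (hVd x).2
    simp only [Function.comp_def, smul_eq_mul] at hFV hHV
    -- The initial data agree only on `I`; derivatives agree because `I` is a neighbourhood of `V
    -- x`.
    have hf0' : deriv (fun v => f v 0) (V x) = deriv f₀ (V x) :=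
      EventuallyEq.deriv_eq (eventually_of_mem hI hf₀)
    have hh0' : deriv (fun v => h v 0) (V x) = deriv h₀ (V x) :=
      EventuallyEq.deriv_eq (eventually_of_mem hI hh₀)
    have hconf := hflow.conformal_profile hT ht (v := V x)
      ⟨(hVJ x).1, (hf₀ _ (hVJ x).1).trans_ne (hVJ x).2⟩
    rw [hf0', hh0', hf₀ _ (hVJ x).1] at hconf
    have hspeed := hS₀.speed_pos (hVJ x)
    -- By the chain rule the left side is the squared speed at time `t` times `V'² = f₀² / (f₀'² +
    -- h₀'²)`, and `hconf` reduces this product to `f²`.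
    have harc : deriv (fun y => f (V y) t) x ^ 2 + deriv (fun y => h (V y) t) x ^ 2 =
        f (V x) t ^ 2 := by
      rw [hFV.deriv, hHV.deriv, xiIntegrand, inv_div, mul_pow, mul_pow, div_pow,
        Real.sq_sqrt hspeed.le, ← mul_add, div_mul_eq_mul_div, div_eq_iff hspeed.ne', ← hconf,
        mul_comm]
    refine ⟨harc, fun θ a b => ?_⟩
    rw [inducedMetric_revolve hFV.differentiableAt hHV.differentiableAt, harc]
    ring
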